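/- Let $k\ge 0$, let $n_1,\dots,n_k\ge 1$ be integers, and let $G$ be a finite abelian group isomorphic to $\mathbb{Z}_{n_1}\times\cdots\times\mathbb{Z}_{n_k}$ (written multiplicatively, with identity $e$). A $G$-graded twisted $\mathbb{C}$-algebra is a (not necessarily associative) $\mathbb{C}$-algebra $W=\bigoplus_{g\in G}W_g$ with an identity element $1\in W_e$, such that each $W_g$ is one-dimensional over $\mathbb{C}$, $W_aW_b\subseteq W_{ab}$ for all $a,b\in G$, and $w_a w_b\neq 0$ for all $a,b\in G$ and all nonzero $w_a\in W_a$, $w_b\in W_b$. A graded isomorphism $W\to V$ of such algebras is an isomorphism of unital $\mathbb{C}$-algebras that maps $W_g$ onto $V_g$ for every $g\in G$. Then $$H^2(G,\mathbb{C}^*)\;\cong\;\bigoplus_{1\le i<j\le k}\mathbb{Z}_{\gcd(n_i,n_j)}$$ as abelian groups, where $G$ acts trivially on $\mathbb{C}^*$, and the number of associative $G$-graded twisted $\mathbb{C}$-algebras, up to graded isomorphism, is exactly $$\prod_{1\le i<j\le k}\gcd(n_i,n_j).$$ -/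

import Mathlib

open scoped DirectSum

universe u v w

/-- A `G`-graded twisted algebra over the field `K`: a unital, not necessarily associative
`K`-algebra `W` with a grading `W = ⨁ g, W_g` such that `W_a W_b ⊆ W_{ab}`, every component
`W_g` is one-dimensional, the product of two nonzero homogeneous elements is nonzero, and the
identity element lies in the component of the identity of `G`. -/
structure GradedTwistedAlgebra (G : Type u) [Group G] (K : Type v) [Field K] where
  carrier : Type w
  [ring : NonAssocRing carrier]
  [module : Module K carrier]
  [isScalarTower : IsScalarTower K carrier carrier]
  [smulCommClass : SMulCommClass K carrier carrier]
  component : G → Submodule K carrier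
  isInternal : letI := Classical.decEq G; DirectSum.IsInternal component
  finrank_component : ∀ g, Module.finrank K (component g) = 1
  mul_mem : ∀ (a b : G) (x y : carrier),
    x ∈ component a → y ∈ component b → x * y ∈ component (a * b)
  mul_ne_zero : ∀ (a b : G) (x y : carrier),
    x ∈ component a → y ∈ component b → x ≠ 0 → y ≠ 0 → x * y ≠ 0
  one_mem : (1 : carrier) ∈ component 1

namespace GradedTwistedAlgebra

attribute [instance] GradedTwistedAlgebra.ring GradedTwistedAlgebra.module
  GradedTwistedAlgebra.isScalarTower GradedTwistedAlgebra.smulCommClass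

variable {G : Type u} [Group G] {K : Type v} [Field K]

/-- Associativity of the multiplication. -/
def IsAssociative (W : GradedTwistedAlgebra.{u, v, w} G K) : Prop :=
  ∀ x y z : W.carrier, x * y * z = x * (y * z)

/-- A `K`-linear map is a graded morphism if it is a unitary homomorphism of algebras and
maps each component into the component of the same degree. -/
structure IsGradedHom (W V : GradedTwistedAlgebra.{u, v, w} G K)
    (φ : W.carrier →ₗ[K] V.carrier) : Prop where
  map_one : φ 1 = 1
  map_mul : ∀ x y, φ (x * y) = φ x * φ y
  map_mem : ∀ (g : G) (x : W.carrier), x ∈ W.component g → φ x ∈ V.component g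

/-- Two `G`-graded twisted algebras are graded-isomorphic if there are mutually inverse graded
morphisms between them. -/
def GradedIsomorphic (W V : GradedTwistedAlgebra.{u, v, w} G K) : Prop :=
  ∃ φ : W.carrier ≃ₗ[K] V.carrier,
    IsGradedHom W V φ.toLinearMap ∧ IsGradedHom V W φ.symm.toLinearMap

theorem IsGradedHom.comp {W V U : GradedTwistedAlgebra.{u, v, w} G K}
    {φ : W.carrier →ₗ[K] V.carrier} {ψ : V.carrier →ₗ[K] U.carrier}
    (hψ : IsGradedHom V U ψ) (hφ : IsGradedHom W V φ) : IsGradedHom W U (ψ.comp φ) where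
  map_one := by simp [hφ.map_one, hψ.map_one]
  map_mul x y := by simp [hφ.map_mul, hψ.map_mul]
  map_mem g x hx := hψ.map_mem g _ (hφ.map_mem g x hx)

theorem gradedIsomorphic_equivalence :
    Equivalence (GradedIsomorphic (G := G) (K := K) :
      GradedTwistedAlgebra.{u, v, w} G K → GradedTwistedAlgebra.{u, v, w} G K → Prop) where
  refl W := ⟨LinearEquiv.refl K W.carrier,
    ⟨rfl, fun _ _ => rfl, fun _ _ h => h⟩, ⟨rfl, fun _ _ => rfl, fun _ _ h => h⟩⟩
  symm := fun ⟨φ, h₁, h₂⟩ => ⟨φ.symm, h₂, h₁⟩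
  trans := fun ⟨φ, h₁, h₂⟩ ⟨ψ, k₁, k₂⟩ => ⟨φ.trans ψ, k₁.comp h₁, h₂.comp k₂⟩

/-- Graded isomorphism as an equivalence relation on the associative `G`-graded twisted
`K`-algebras (with underlying set in the universe `w`). -/
def associativeSetoid (G : Type u) [Group G] (K : Type v) [Field K] :
    Setoid {W : GradedTwistedAlgebra.{u, v, w} G K // W.IsAssociative} where
  r W V := GradedIsomorphic W.1 V.1
  iseqv := gradedIsomorphic_equivalence.comap Subtype.val

/-- The graded isomorphism classes of associative `G`-graded twisted `K`-algebras. -/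
def AssociativeClasses (G : Type u) [Group G] (K : Type v) [Field K] :
    Type (max u v (w + 1)) :=
  Quotient (associativeSetoid.{u, v, w} G K)

end GradedTwistedAlgebra

/-! Write A for the additive group of ℂˣ. A 2-cocycle c on G has the commutator pairing c(g,h) -
c(h,g), which is biadditive and alternating and, G being abelian, vanishes on coboundaries.
Conversely, if it vanishes then c is symmetric, so it defines an abelian extension of G by A; this
splits because A is divisible, hence injective, and c is a coboundary
(`exists_coboundary_of_symmetric`). The class of c is thus determined by the pairing on generators
(eᵢ, eⱼ) with i < j. Each such value is killed by gcd(nᵢ, nⱼ), so it ranges over a group of roots of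
unity isomorphic to ℤ/gcd(nᵢ, nⱼ). Every choice of values is attained by an upper triangular
bilinear form, which is itself a cocycle.

For the count, pick a nonzero vector in each component of an algebra. Its structure constants form a
cocycle exactly when the product is associative, and rescaling the vectors changes them by a
coboundary. Every cocycle arises, so isomorphism classes correspond to H². -/

/-! ### Symmetric cocycles and abelian extensions -/

section SymmetricCocycle

variable {G A : Type*} [CommGroup G] [AddCommGroup A]

/-- The underlying type of the extension of `G` by `A` attached to a symmetric cocycle. -/
@[ext]
structure CocycleExtension (c : G × G → A) where
  /-- The component in `A`. -/
  base : A
  /-- The image in `G`. -/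
  degree : G

theorem cocycle_one_left (c : G × G → A)
    (hc : ∀ g h j : G, c (g * h, j) + c (g, h) = c (h, j) + c (g, h * j)) (g : G) :
    c (1, g) = c (1, 1) := by
  have := hc 1 1 g
  simp only [one_mul] at this
  exact (add_left_cancel this).symm

/-- The group law `(a, g) + (b, h) = (a + b + c (g, h), g * h)`. -/
@[reducible]
def CocycleExtension.addCommGroup (c : G × G → A)
    (hc : ∀ g h j : G, c (g * h, j) + c (g, h) = c (h, j) + c (g, h * j))
    (hs : ∀ g h : G, c (g, h) = c (h, g)) : AddCommGroup (CocycleExtension c) :=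
  letI : Add (CocycleExtension c) :=
    ⟨fun x y => ⟨x.base + y.base + c (x.degree, y.degree), x.degree * y.degree⟩⟩
  -- The cocycle is not assumed normalized, so the neutral element is shifted by c(1,1).
  letI : Zero (CocycleExtension c) := ⟨⟨-c (1, 1), 1⟩⟩
  letI : Neg (CocycleExtension c) :=
    ⟨fun x => ⟨-x.base - c (x.degree⁻¹, x.degree) - c (1, 1), x.degree⁻¹⟩⟩
  have add_def : ∀ x y : CocycleExtension c,
    x + y = ⟨x.base + y.base + c (x.degree, y.degree), x.degree * y.degree⟩ := fun _ _ => rfl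
  have zero_def : (0 : CocycleExtension c) = ⟨-c (1, 1), 1⟩ := rfl
  have neg_def : ∀ x : CocycleExtension c,
    -x = ⟨-x.base - c (x.degree⁻¹, x.degree) - c (1, 1), x.degree⁻¹⟩ := fun _ => rfl
  have zero_add' : ∀ x : CocycleExtension c, 0 + x = x := fun x => by
    rw [add_def, zero_def]
    ext
    · simp only [cocycle_one_left c hc]
      abel
    · exact one_mul _
  have add_comm' : ∀ x y : CocycleExtension c, x + y = y + x := fun x y => by
    rw [add_def, add_def, hs, mul_comm, add_comm x.base]
  { add_assoc := fun x y z => by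
      simp only [add_def]
      ext
      · simp only [eq_sub_of_add_eq (hc x.degree y.degree z.degree)]
        abel
      · exact mul_assoc _ _ _
    zero_add := zero_add'
    add_zero := fun x => (add_comm' x 0).trans (zero_add' x)
    add_comm := add_comm'
    neg_add_cancel := fun x => by
      rw [add_def, neg_def, zero_def]
      ext
      · simp only
        abel
      · exact inv_mul_cancel _
    nsmul := nsmulRec
    zsmul := zsmulRec }

/-- A symmetric `2`-cocycle with values in a divisible group is a coboundary. -/
theorem exists_coboundary_of_symmetric (hA : Module.Baer ℤ A) (c : G × G → A)
    (hc : ∀ g h j : G, c (g * h, j) + c (g, h) = c (h, j) + c (g, h * j))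
    (hs : ∀ g h : G, c (g, h) = c (h, g)) :
    ∃ f : G → A, ∀ g h, c (g, h) = f h - f (g * h) + f g := by
  let _ := CocycleExtension.addCommGroup c hc hs
  have add_def : ∀ x y : CocycleExtension c,
    x + y = ⟨x.base + y.base + c (x.degree, y.degree), x.degree * y.degree⟩ := fun _ _ => rfl
  let i : A →+ CocycleExtension c := AddMonoidHom.mk' (fun a => ⟨a - c (1, 1), 1⟩) fun a b => by
    rw [add_def]
    ext
    · simp only
      abel
    · exact (mul_one _).symm
  have hi : Function.Injective i := fun a b h =>
    sub_left_injective (congrArg CocycleExtension.base h)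
  -- Injectivity of A extends its identity map along i to a retraction r. Restricting r to the
  -- section g ↦ (0, g) gives the cochain.
  obtain ⟨r, hr⟩ := hA.extension_property_addMonoidHom i hi (AddMonoidHom.id A)
  have hr' : ∀ a, r (i a) = a := fun a => DFunLike.congr_fun hr a
  refine ⟨fun g => r ⟨0, g⟩, fun g h => ?_⟩
  have key : (⟨0, g⟩ : CocycleExtension c) + ⟨0, h⟩ = i (c (g, h)) + ⟨0, g * h⟩ := by
    rw [add_def, add_def]
    ext
    · change 0 + 0 + c (g, h) = c (g, h) - c (1, 1) + 0 + c (1, g * h)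
      rw [cocycle_one_left c hc (g * h)]
      abel
    · exact (one_mul _).symm
  have := congrArg r key
  rw [map_add, map_add, hr'] at this
  rw [eq_sub_of_add_eq this.symm]
  abel

end SymmetricCocycle

/-! ### The commutator pairing -/

section CommutatorPairing

variable {G A : Type*} [CommGroup G] [AddCommGroup A]

/-- Combines the cocycle identities at (g,h,j), (j,g,h) and (g,j,h), using commutativity of G. -/
theorem commutator_mul_left (c : G × G → A)
    (hc : ∀ g h j : G, c (g * h, j) + c (g, h) = c (h, j) + c (g, h * j)) (g h j : G) :
    c (g * h, j) - c (j, g * h) = (c (g, j) - c (j, g)) + (c (h, j) - c (j, h)) := by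
  have h1 := eq_sub_of_add_eq (hc g h j)
  have h2 := eq_sub_of_add_eq' (hc j g h).symm
  have h3 := eq_sub_of_add_eq (hc g j h)
  rw [h1, h2, mul_comm j g, h3, mul_comm j h]
  abel

/-- The pairing `(g, h) ↦ c (g, h) - c (h, g)` of a `2`-cocycle is biadditive. -/
def commutatorPairing (c : G × G → A)
    (hc : ∀ g h j : G, c (g * h, j) + c (g, h) = c (h, j) + c (g, h * j)) :
    Additive G →+ Additive G →+ A :=
  AddMonoidHom.mk'
    (fun g => AddMonoidHom.mk'
      (fun h => c (g.toMul, h.toMul) - c (h.toMul, g.toMul))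
      fun h j => by
        have := commutator_mul_left c hc h.toMul j.toMul g.toMul
        rw [toMul_add, ← neg_sub, this]
        abel)
    fun g h => by
      ext j
      exact commutator_mul_left c hc g.toMul h.toMul _

end CommutatorPairing

/-! ### Pairings on products of cyclic groups -/

section Bilinear

variable {k : ℕ} {n : Fin k → ℕ} {A : Type*} [AddCommGroup A]

theorem AddMonoidHom.pi_zmod_ext {M : Type*} [AddCommMonoid M] {f g : (∀ i, ZMod (n i)) →+ M}
    (h : ∀ i, f (Pi.single i 1) = g (Pi.single i 1)) : f = g := by
  refine AddMonoidHom.functions_ext' _ _ _ fun i => ?_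
  have : (f.comp (AddMonoidHom.single _ i)).comp (Int.castAddHom (ZMod (n i))) =
      (g.comp (AddMonoidHom.single _ i)).comp (Int.castAddHom (ZMod (n i))) := by
    apply AddMonoidHom.ext_int
    simpa using h i
  exact (AddMonoidHom.cancel_right ZMod.intCast_surjective).1 this

/-- An alternating pairing on `∏ i, ℤ/nᵢ` vanishes if it vanishes on all pairs `(eᵢ, eⱼ)` with
`i < j`. -/
theorem alternating_eq_zero (β : (∀ i, ZMod (n i)) →+ (∀ i, ZMod (n i)) →+ A)
    (halt : ∀ x, β x x = 0) (hskew : ∀ x y, β x y = -β y x)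
    (h : ∀ i j, i < j → β (Pi.single i 1) (Pi.single j 1) = 0) : β = 0 := by
  refine AddMonoidHom.pi_zmod_ext fun i => AddMonoidHom.pi_zmod_ext fun j => ?_
  rcases lt_trichotomy i j with hij | rfl | hij
  · simpa using h i j hij
  · simpa using halt _
  · rw [hskew, h j i hij]
    simp

/-- Since nᵢ kills eᵢ and nⱼ kills eⱼ, the order of the value divides both. -/
theorem gcd_nsmul_pairing_eq_zero (β : (∀ i, ZMod (n i)) →+ (∀ i, ZMod (n i)) →+ A)
    (i j : Fin k) :
    Nat.gcd (n i) (n j) • β (Pi.single i 1) (Pi.single j 1) = 0 := by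
  have hz : ∀ i, n i • (Pi.single i 1 : ∀ i, ZMod (n i)) = 0 := fun i => by
    rw [← Pi.single_smul]
    simp
  rw [← addOrderOf_dvd_iff_nsmul_eq_zero]
  refine Nat.dvd_gcd ?_ ?_ <;> rw [addOrderOf_dvd_iff_nsmul_eq_zero]
  · rw [← AddMonoidHom.nsmul_apply, ← map_nsmul, hz, map_zero, AddMonoidHom.zero_apply]
  · rw [← map_nsmul, hz, map_zero]

/-- The pairs of indices `i < j`. -/
abbrev IndexPair (k : ℕ) : Type := {p : Fin k × Fin k // p.1 < p.2}

/-- The greatest common divisor attached to a pair of indices. -/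
abbrev pairGcd (n : Fin k → ℕ) (p : IndexPair k) : ℕ := Nat.gcd (n p.1.1) (n p.1.2)

/-- The bilinear form `(x, y) ↦ ∑ p, ι p (t p * x i * y j)` on `∏ i, ℤ/nᵢ`, where `p = (i, j)`. -/
def triangularForm (ι : ∀ p : IndexPair k, ZMod (pairGcd n p) →+ A)
    (t : ∀ p : IndexPair k, ZMod (pairGcd n p)) (x y : ∀ i, ZMod (n i)) : A :=
  ∑ p : IndexPair k, ι p (t p *
    (ZMod.castHom (Nat.gcd_dvd_left (n p.1.1) (n p.1.2)) (ZMod (pairGcd n p)) (x p.1.1) *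
    ZMod.castHom (Nat.gcd_dvd_right (n p.1.1) (n p.1.2)) (ZMod (pairGcd n p)) (y p.1.2)))

variable (ι : ∀ p : IndexPair k, ZMod (pairGcd n p) →+ A)

theorem triangularForm_add_left (t) (x x' y : ∀ i, ZMod (n i)) :
    triangularForm ι t (x + x') y = triangularForm ι t x y + triangularForm ι t x' y := by
  simp only [triangularForm, Pi.add_apply, map_add, add_mul, mul_add, Finset.sum_add_distrib]

theorem triangularForm_add_right (t) (x y y' : ∀ i, ZMod (n i)) :
    triangularForm ι t x (y + y') = triangularForm ι t x y + triangularForm ι t x y' := by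
  simp only [triangularForm, Pi.add_apply, map_add, mul_add, Finset.sum_add_distrib]

theorem triangularForm_add (t t') (x y : ∀ i, ZMod (n i)) :
    triangularForm ι (t + t') x y = triangularForm ι t x y + triangularForm ι t' x y := by
  simp only [triangularForm, Pi.add_apply, map_add, add_mul, Finset.sum_add_distrib]

theorem triangularForm_single (t) (p : IndexPair k) :
    triangularForm ι t (Pi.single p.1.1 1) (Pi.single p.1.2 1) = ι p (t p) := by
  rw [triangularForm, Finset.sum_eq_single p]
  · rw [Pi.single_eq_same, Pi.single_eq_same, map_one, map_one, mul_one, mul_one]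
  · intro q _ hq
    by_cases h1 : q.1.1 = p.1.1
    · have h2 : q.1.2 ≠ p.1.2 := fun h2 => hq (Subtype.ext (Prod.ext h1 h2))
      rw [Pi.single_eq_of_ne h2]
      simp
    · rw [Pi.single_eq_of_ne h1]
      simp
  · simp

theorem triangularForm_single_swap (t) (p : IndexPair k) :
    triangularForm ι t (Pi.single p.1.2 1) (Pi.single p.1.1 1) = 0 := by
  refine Finset.sum_eq_zero fun q _ => ?_
  by_cases h1 : q.1.1 = p.1.2
  · have h2 : q.1.2 ≠ p.1.1 := fun h2 => by
      have := q.2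
      rw [h1, h2] at this
      exact lt_asymm this p.2
    rw [Pi.single_eq_of_ne h2]
    simp
  · rw [Pi.single_eq_of_ne h1]
    simp

end Bilinear

/-! ### Computing H² from the pairing -/

section SecondCohomology

open groupCohomology

variable {G A : Type} [CommGroup G] [AddCommGroup A]

theorem mem_cocycles₂_trivial_iff (c : G × G → A) :
    c ∈ cocycles₂ (Rep.trivial ℤ G A) ↔
      ∀ g h j : G, c (g * h, j) + c (g, h) = c (h, j) + c (g, h * j) :=
  mem_cocycles₂_iff (A := Rep.trivial ℤ G A) c

theorem mem_coboundaries₂_trivial_iff (c : G × G → A) :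
    c ∈ coboundaries₂ (Rep.trivial ℤ G A) ↔
      ∃ f : G → A, ∀ g h, c (g, h) = f h - f (g * h) + f g := by
  constructor
  · rintro ⟨f, hf⟩
    exact ⟨f, fun g h => (congrFun hf (g, h)).symm⟩
  · rintro ⟨f, hf⟩
    exact ⟨f, funext fun x => (hf x.1 x.2).symm⟩

variable {k : ℕ} {n : Fin k → ℕ}

/-- The commutator pairing of a cocycle, transported along `e`. -/
def pairingOn (e : Additive G ≃+ ∀ i, ZMod (n i)) (c : G × G → A)
    (hc : ∀ g h j : G, c (g * h, j) + c (g, h) = c (h, j) + c (g, h * j)) :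
    (∀ i, ZMod (n i)) →+ (∀ i, ZMod (n i)) →+ A :=
  ((commutatorPairing c hc).compl₂ e.symm.toAddMonoidHom).comp e.symm.toAddMonoidHom

theorem pairingOn_apply (e : Additive G ≃+ ∀ i, ZMod (n i)) (c : G × G → A)
    (hc : ∀ g h j : G, c (g * h, j) + c (g, h) = c (h, j) + c (g, h * j)) (x y) :
    pairingOn e c hc x y = c ((e.symm x).toMul, (e.symm y).toMul) -
      c ((e.symm y).toMul, (e.symm x).toMul) := rfl

theorem symmetric_of_pairingOn_eq_zero (e : Additive G ≃+ ∀ i, ZMod (n i)) (c : G × G → A)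
    (hc : ∀ g h j : G, c (g * h, j) + c (g, h) = c (h, j) + c (g, h * j))
    (h0 : ∀ i j, i < j → pairingOn e c hc (Pi.single i 1) (Pi.single j 1) = 0) (g h : G) :
    c (g, h) = c (h, g) := by
  have := alternating_eq_zero (pairingOn e c hc) (fun x => by rw [pairingOn_apply, sub_self])
    (fun x y => by rw [pairingOn_apply, pairingOn_apply, neg_sub]) h0
  have := DFunLike.congr_fun (DFunLike.congr_fun this (e (.ofMul g))) (e (.ofMul h))
  rw [pairingOn_apply, e.symm_apply_apply, e.symm_apply_apply] at this
  exact sub_eq_zero.1 this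

/-- The cocycle given by `triangularForm`. -/
def formCocycle (e : Additive G ≃+ ∀ i, ZMod (n i))
    (ι : ∀ p : IndexPair k, ZMod (pairGcd n p) →+ A)
    (t : ∀ p : IndexPair k, ZMod (pairGcd n p)) : cocycles₂ (Rep.trivial ℤ G A) :=
  ⟨fun x => triangularForm ι t (e (.ofMul x.1)) (e (.ofMul x.2)),
    (mem_cocycles₂_trivial_iff _).2 fun g h j => by
      simp only [ofMul_mul, map_add, triangularForm_add_left, triangularForm_add_right]
      abel⟩

theorem pairingOn_formCocycle (e : Additive G ≃+ ∀ i, ZMod (n i))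
    (ι : ∀ p : IndexPair k, ZMod (pairGcd n p) →+ A)
    (t : ∀ p : IndexPair k, ZMod (pairGcd n p)) (p : IndexPair k) :
    pairingOn e (formCocycle e ι t).1 ((mem_cocycles₂_trivial_iff _).1 (formCocycle e ι t).2)
      (Pi.single p.1.1 1) (Pi.single p.1.2 1) = ι p (t p) := by
  have e1 : ∀ x, e (Additive.ofMul (e.symm x).toMul) = x := e.apply_symm_apply
  rw [pairingOn_apply]
  simp only [formCocycle, e1, triangularForm_single, triangularForm_single_swap, sub_zero]

/-- The homomorphism sending `t` to the class of the cocycle given by `triangularForm`. -/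
noncomputable def formClass (e : Additive G ≃+ ∀ i, ZMod (n i))
    (ι : ∀ p : IndexPair k, ZMod (pairGcd n p) →+ A) :
    (∀ p : IndexPair k, ZMod (pairGcd n p)) →+ groupCohomology (Rep.trivial ℤ G A) 2 :=
  AddMonoidHom.comp (H2π (Rep.trivial ℤ G A)).hom.toAddMonoidHom <|
    AddMonoidHom.mk' (formCocycle e ι) fun t t' => by
      ext g h
      exact triangularForm_add ι t t' _ _

/-- A coboundary on an abelian group is symmetric, so its pairing is zero, while the pairing of the
form cocycle reads off ι p (t p). -/
theorem formClass_injective (e : Additive G ≃+ ∀ i, ZMod (n i))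
    (ι : ∀ p : IndexPair k, ZMod (pairGcd n p) →+ A) (hι : ∀ p, Function.Injective (ι p)) :
    Function.Injective (formClass e ι) := by
  rw [injective_iff_map_eq_zero]
  intro t ht
  obtain ⟨f, hf⟩ := (mem_coboundaries₂_trivial_iff _).1
    ((H2π_eq_zero_iff (A := Rep.trivial ℤ G A) _).1 ht)
  ext p
  have h1 := pairingOn_formCocycle e ι t p
  have h2 : ∀ g h, (formCocycle e ι t).1 (g, h) = f h - f (g * h) + f g := hf
  rw [pairingOn_apply, h2, h2, mul_comm] at h1
  refine (injective_iff_map_eq_zero _).1 (hι p) _ (h1.symm.trans ?_)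
  abel

/-- Choose t so that the form cocycle has the same pairing as c on generators; the difference is
then symmetric, hence a coboundary. -/
theorem formClass_surjective (hA : Module.Baer ℤ A) (e : Additive G ≃+ ∀ i, ZMod (n i))
    (ι : ∀ p : IndexPair k, ZMod (pairGcd n p) →+ A)
    (hι : ∀ p x, pairGcd n p • x = 0 → ∃ s, ι p s = x) :
    Function.Surjective (formClass e ι) := by
  intro y
  induction y using H2_induction_on with
  | h c =>
    have hc := (mem_cocycles₂_trivial_iff _).1 c.2
    let β := pairingOn e c.1 hc
    choose t ht using fun p : IndexPair k => hι p _ (gcd_nsmul_pairing_eq_zero β p.1.1 p.1.2)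
    refine ⟨t, (H2π_eq_iff (A := Rep.trivial ℤ G A) _ _).2
      ((mem_coboundaries₂_trivial_iff _).2 ?_)⟩
    have hb := (mem_cocycles₂_trivial_iff _).1 (formCocycle e ι t - c).2
    refine exists_coboundary_of_symmetric hA _ hb (symmetric_of_pairingOn_eq_zero e _ hb ?_)
    intro i j hij
    have h1 := (pairingOn_formCocycle e ι t ⟨(i, j), hij⟩).trans (ht _)
    refine Eq.trans ?_ (sub_eq_zero.2 h1)
    -- The pairing is additive in the cocycle.
    exact sub_sub_sub_comm _ _ _ _

end SecondCohomology

/-! ### Divisibility and roots of unity in ℂˣ -/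

section Complex

theorem baer_additive_units_complex : Module.Baer ℤ (Additive ℂˣ) := by
  have key : ∀ m : ℤ, m ≠ 0 → Function.Surjective fun x : Additive ℂˣ => m • x := by
    intro m hm x
    obtain ⟨z, hz⟩ := IsAlgClosed.exists_pow_nat_eq (x.toMul : ℂ) (Int.natAbs_pos.2 hm)
    have hz0 : z ≠ 0 := by
      rintro rfl
      rw [zero_pow (Int.natAbs_ne_zero.2 hm)] at hz
      exact x.toMul.ne_zero hz.symm
    have h : m.natAbs • Additive.ofMul (Units.mk0 z hz0) = x :=
      Additive.toMul.injective (Units.ext hz)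
    rcases Int.natAbs_eq m with h' | h'
    · exact ⟨Additive.ofMul (Units.mk0 z hz0), by simp only; rw [h', natCast_zsmul, h]⟩
    · exact ⟨-Additive.ofMul (Units.mk0 z hz0), by
        simp only; rw [h', neg_smul_neg, natCast_zsmul, h]⟩
  let _ : DivisibleBy (Additive ℂˣ) ℤ := divisibleByOfSMulRightSurj _ _ fun h => key _ h
  exact Module.Baer.of_divisible _

/-- The embedding of `ℤ/d` into `ℂˣ` with image the group of `d`-th roots of unity. -/
theorem exists_zmod_embedding_units_complex (d : ℕ) (hd : 0 < d) :
    ∃ ι : ZMod d →+ Additive ℂˣ, Function.Injective ι ∧ ∀ x, d • x = 0 → ∃ s, ι s = x := by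
  have : NeZero d := ⟨hd.ne'⟩
  have h0 := Complex.isPrimitiveRoot_exp d hd.ne'
  have hζ := h0.isUnit_unit hd.ne'
  set ζ := (h0.isUnit hd.ne').unit
  refine ⟨(MonoidHom.toAdditive (Subgroup.zpowers ζ).subtype).comp
    hζ.zmodEquivZPowers.toAddMonoidHom,
    Subtype.val_injective.comp hζ.zmodEquivZPowers.injective, fun x hx => ?_⟩
  have hx' : x.toMul ∈ Subgroup.zpowers ζ := by
    rw [hζ.zpowers_eq, mem_rootsOfUnity]
    exact hx
  refine ⟨hζ.zmodEquivZPowers.symm (Additive.ofMul ⟨x.toMul, hx'⟩), ?_⟩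
  change (Subtype.val (Additive.toMul (hζ.zmodEquivZPowers (hζ.zmodEquivZPowers.symm _))) : ℂˣ) = _
  rw [AddEquiv.apply_symm_apply]
  rfl

/-- The second cohomology group of a product of cyclic groups with coefficients in `ℂˣ`. -/
theorem nonempty_pi_addEquiv_groupCohomology {k : ℕ} {n : Fin k → ℕ} (hn : ∀ i, 0 < n i)
    {G : Type} [CommGroup G] (e : G ≃* ((i : Fin k) → Multiplicative (ZMod (n i)))) :
    Nonempty ((∀ p : IndexPair k, ZMod (pairGcd n p)) ≃+
      groupCohomology (Rep.trivial ℤ G (Additive ℂˣ)) 2) := by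
  choose ι hinj hsurj using fun p : IndexPair k =>
    exists_zmod_embedding_units_complex (pairGcd n p) (Nat.gcd_pos_of_pos_left _ (hn p.1.1))
  let e' : Additive G ≃+ ∀ i, ZMod (n i) :=
    { toFun := fun g i => (e g.toMul i).toAdd
      invFun := fun x => .ofMul (e.symm fun i => .ofAdd (x i))
      left_inv := fun g => e.symm_apply_apply g.toMul
      right_inv := fun x => e.apply_symm_apply fun i => .ofAdd (x i)
      map_add' := fun g h => e.map_mul g.toMul h.toMul }
  exact ⟨AddEquiv.ofBijective (formClass e' ι)
    ⟨formClass_injective e' ι hinj, formClass_surjective baer_additive_units_complex e' ι hsurj⟩⟩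

end Complex

namespace GradedTwistedAlgebra

/-! ### Homogeneous bases and structure constants -/

section Frame

variable {G : Type u} [Group G] {K : Type v} [Field K]

/-- A family of nonzero homogeneous elements `x g ∈ W_g`, with structure constants `c`. -/
structure IsFrame (W : GradedTwistedAlgebra.{u, v, w} G K) (x : G → W.carrier)
    (c : G × G → Kˣ) : Prop where
  mem : ∀ g, x g ∈ W.component g
  ne_zero : ∀ g, x g ≠ 0
  mul : ∀ a b, x a * x b = c (a, b) • x (a * b)

theorem exists_smul_eq (W : GradedTwistedAlgebra.{u, v, w} G K) {g : G} {x y : W.carrier}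
    (hx : x ∈ W.component g) (hx0 : x ≠ 0) (hy : y ∈ W.component g) : ∃ r : K, r • x = y := by
  obtain ⟨r, hr⟩ := (finrank_eq_one_iff_of_nonzero' (⟨x, hx⟩ : W.component g)
    fun h => hx0 (congrArg Subtype.val h)).1 (W.finrank_component g) ⟨y, hy⟩
  exact ⟨r, congrArg Subtype.val hr⟩

theorem exists_units_smul_eq (W : GradedTwistedAlgebra.{u, v, w} G K) {g : G} {x y : W.carrier}
    (hx : x ∈ W.component g) (hx0 : x ≠ 0) (hy : y ∈ W.component g) (hy0 : y ≠ 0) :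
    ∃ r : Kˣ, r • x = y := by
  obtain ⟨r, hr⟩ := W.exists_smul_eq hx hx0 hy
  refine ⟨Units.mk0 r ?_, hr⟩
  rintro rfl
  exact hy0 (by rw [← hr, zero_smul])

theorem exists_isFrame (W : GradedTwistedAlgebra.{u, v, w} G K) :
    ∃ (x : G → W.carrier) (c : G × G → Kˣ), W.IsFrame x c := by
  have h : ∀ g, ∃ x ∈ W.component g, x ≠ 0 := fun g => by
    have : W.component g ≠ ⊥ := fun h => by
      have := W.finrank_component g
      rw [h, finrank_bot] at this
      exact zero_ne_one this
    exact (Submodule.ne_bot_iff _).1 this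
  choose x hx hx0 using h
  choose c hc using fun p : G × G => W.exists_units_smul_eq (hx (p.1 * p.2)) (hx0 _)
    (W.mul_mem _ _ _ _ (hx p.1) (hx p.2)) (W.mul_ne_zero _ _ _ _ (hx p.1) (hx p.2) (hx0 _) (hx0 _))
  exact ⟨x, c, hx, hx0, fun a b => (hc (a, b)).symm⟩

namespace IsFrame

variable {W V : GradedTwistedAlgebra.{u, v, w} G K} {x : G → W.carrier} {y : G → V.carrier}
  {c d : G × G → Kˣ}

theorem linearIndependent (hx : W.IsFrame x c) : LinearIndependent K x := by
  let _ := Classical.decEq G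
  exact (DirectSum.IsInternal.submodule_iSupIndep W.isInternal).linearIndependent _ hx.mem hx.ne_zero

theorem top_le_span (hx : W.IsFrame x c) : ⊤ ≤ Submodule.span K (Set.range x) := by
  let _ := Classical.decEq G
  have h : iSup W.component = ⊤ := DirectSum.IsInternal.submodule_iSup_eq_top W.isInternal
  rw [← h, iSup_le_iff]
  intro g z hz
  obtain ⟨r, rfl⟩ := W.exists_smul_eq (hx.mem g) (hx.ne_zero g) hz
  exact Submodule.smul_mem _ _ (Submodule.subset_span ⟨g, rfl⟩)

/-- A frame is a basis. -/
noncomputable def basis (hx : W.IsFrame x c) : Module.Basis G K W.carrier :=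
  Module.Basis.mk hx.linearIndependent hx.top_le_span

theorem basis_apply (hx : W.IsFrame x c) (g : G) : hx.basis g = x g :=
  Module.Basis.mk_apply _ _ g

theorem isGradedHom_equiv (hx : W.IsFrame x c) (hy : V.IsFrame y c) :
    IsGradedHom W V (hx.basis.equiv hy.basis (Equiv.refl G)).toLinearMap := by
  set φ := hx.basis.equiv hy.basis (Equiv.refl G)
  have hφ : ∀ g, φ (x g) = y g := fun g => by
    rw [← hx.basis_apply, Module.Basis.equiv_apply, hy.basis_apply, Equiv.refl_apply]
  have hmul : ∀ a b, φ (a * b) = φ a * φ b := by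
    have : (LinearMap.mul K W.carrier).compr₂ φ.toLinearMap =
        (LinearMap.mul K V.carrier).compl₁₂ φ.toLinearMap φ.toLinearMap := by
      refine hx.basis.ext fun a => hx.basis.ext fun b => ?_
      simp only [hx.basis_apply, LinearMap.compr₂_apply, LinearMap.compl₁₂_apply,
        LinearMap.mul_apply', LinearEquiv.coe_coe, hφ, hx.mul, hy.mul, Units.smul_def, map_smul]
    exact fun a b => LinearMap.congr_fun₂ this a b
  refine ⟨?_, hmul, fun g z hz => ?_⟩
  -- The unit need not belong to the frame; its image is recovered from multiplicativity and
  -- surjectivity.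
  · have : φ 1 * φ (φ.symm 1) = 1 := by rw [← hmul, one_mul, φ.apply_symm_apply]
    rwa [φ.apply_symm_apply, mul_one] at this
  · obtain ⟨r, rfl⟩ := W.exists_smul_eq (hx.mem g) (hx.ne_zero g) hz
    rw [map_smul, LinearEquiv.coe_coe, hφ]
    exact Submodule.smul_mem _ _ (hy.mem g)

theorem gradedIsomorphic (hx : W.IsFrame x c) (hy : V.IsFrame y c) : GradedIsomorphic W V :=
  ⟨hx.basis.equiv hy.basis (Equiv.refl G), hx.isGradedHom_equiv hy, hy.isGradedHom_equiv hx⟩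

theorem smul (hx : W.IsFrame x c) (f : G → Kˣ)
    (h : ∀ a b, d (a, b) * f (a * b) = f a * f b * c (a, b)) :
    W.IsFrame (fun g => f g • x g) d where
  mem g := Submodule.smul_mem _ _ (hx.mem g)
  ne_zero g := (smul_ne_zero_iff_ne (f g)).2 (hx.ne_zero g)
  mul a b := by
    simp only [Units.smul_def, smul_mul_smul_comm]
    rw [hx.mul, Units.smul_def, smul_smul, smul_smul]
    congr 1
    exact_mod_cast (h a b).symm

/-- Graded isomorphism in terms of structure constants. -/
theorem gradedIsomorphic_iff (hx : W.IsFrame x c) (hy : V.IsFrame y d) :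
    GradedIsomorphic W V ↔ ∃ f : G → Kˣ, ∀ a b, c (a, b) * f (a * b) = f a * f b * d (a, b) := by
  refine ⟨?_, fun ⟨f, hf⟩ => hx.gradedIsomorphic (hy.smul f hf)⟩
  rintro ⟨φ, h, -⟩
  choose f hf using fun g => V.exists_units_smul_eq (hy.mem g) (hy.ne_zero g)
    (h.map_mem g _ (hx.mem g)) (φ.map_ne_zero_iff.2 (hx.ne_zero g))
  refine ⟨f, fun a b => ?_⟩
  have := h.map_mul (x a) (x b)
  rw [hx.mul, Units.smul_def, map_smul, ← hf, ← hf, ← hf] at this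
  simp only [Units.smul_def, smul_mul_smul_comm] at this
  rw [hy.mul, Units.smul_def, smul_smul, smul_smul] at this
  exact Units.ext (smul_left_injective K (hy.ne_zero _) this)

/-- Compare the coefficients of x (g * h * j) in the two bracketings. -/
theorem cocycle (hx : W.IsFrame x c) (hW : W.IsAssociative) (g h j : G) :
    c (g * h, j) * c (g, h) = c (h, j) * c (g, h * j) := by
  have := hW (x g) (x h) (x j)
  simp only [hx.mul, Units.smul_def, smul_mul_assoc, mul_smul_comm, smul_smul] at this
  rw [mul_assoc g] at this
  have := smul_left_injective K (hx.ne_zero _) this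
  exact (mul_comm _ _).trans (Units.ext this)

end IsFrame

/-- The graded twisted algebra given by a basis of an associative algebra that is multiplicative
up to nonzero scalars. -/
def ofBasis {R : Type w} [Ring R] [Algebra K R] (b : Module.Basis G K R) (c : G × G → Kˣ)
    (hmul : ∀ g h, b g * b h = c (g, h) • b (g * h)) (hone : (1 : R) ∈ Submodule.span K {b 1}) :
    GradedTwistedAlgebra.{u, v, w} G K where
  carrier := R
  component g := Submodule.span K {b g}
  isInternal := by
    let _ := Classical.decEq G
    refine DirectSum.isInternal_submodule_of_iSupIndep_of_iSup_eq_top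
      b.linearIndependent.iSupIndep_span_singleton ?_
    rw [← Submodule.span_range_eq_iSup, b.span_eq]
  finrank_component g := finrank_span_singleton (b.ne_zero g)
  mul_mem g h x y hx hy := by
    obtain ⟨r, rfl⟩ := Submodule.mem_span_singleton.1 hx
    obtain ⟨s, rfl⟩ := Submodule.mem_span_singleton.1 hy
    rw [smul_mul_smul_comm, hmul, Units.smul_def, smul_smul]
    exact Submodule.smul_mem _ _ (Submodule.mem_span_singleton_self _)
  mul_ne_zero g h x y hx hy hx0 hy0 := by
    obtain ⟨r, rfl⟩ := Submodule.mem_span_singleton.1 hx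
    obtain ⟨s, rfl⟩ := Submodule.mem_span_singleton.1 hy
    rw [smul_mul_smul_comm, hmul, Units.smul_def, smul_smul]
    exact smul_ne_zero (_root_.mul_ne_zero (_root_.mul_ne_zero (left_ne_zero_of_smul hx0)
      (left_ne_zero_of_smul hy0)) (c (g, h)).ne_zero) (b.ne_zero _)
  one_mem := hone

theorem exists_isFrame_of_basis {R : Type w} [Ring R] [Algebra K R] (b : Module.Basis G K R)
    (c : G × G → Kˣ) (hmul : ∀ g h, b g * b h = c (g, h) • b (g * h))
    (hone : (1 : R) ∈ Submodule.span K {b 1}) :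
    ∃ (W : GradedTwistedAlgebra.{u, v, w} G K) (x : G → W.carrier),
      W.IsAssociative ∧ W.IsFrame x c :=
  ⟨ofBasis b c hmul hone, fun g => b g, mul_assoc (G := R),
    { mem := fun g => Submodule.mem_span_singleton_self (R := K) (b g)
      ne_zero := b.ne_zero
      mul := hmul }⟩

end Frame

/-! ### Realizing a cocycle by twisted translations; working inside an endomorphism ring makes
associativity automatic -/

section TwistedGroupAlgebra

variable {G : Type} [Group G] {K : Type} [Field K]

/-- The twisted left translation by `g`. -/
def twistedTranslation (c : G × G → Kˣ) (g : G) : Module.End K (ULift.{w} G → K) where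
  toFun f := fun x => c (g, g⁻¹ * x.down) * f ⟨g⁻¹ * x.down⟩
  map_add' _ _ := funext fun _ => mul_add _ _ _
  map_smul' _ _ := funext fun _ => mul_left_comm _ _ _

theorem twistedTranslation_apply (c : G × G → Kˣ) (g : G) (f : ULift.{w} G → K)
    (x : ULift.{w} G) :
    twistedTranslation c g f x = c (g, g⁻¹ * x.down) * f ⟨g⁻¹ * x.down⟩ := rfl

theorem twistedTranslation_mul (c : G × G → Kˣ)
    (hc : ∀ g h j, c (g * h, j) * c (g, h) = c (h, j) * c (g, h * j)) (g h : G) :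
    twistedTranslation.{w} c g * twistedTranslation c h =
      c (g, h) • twistedTranslation c (g * h) := by
  ext f x
  -- The third argument j is chosen with g * h * j = x.
  have := congrArg Units.val (hc g h (h⁻¹ * (g⁻¹ * x.down)))
  rw [mul_inv_cancel_left, Units.val_mul, Units.val_mul] at this
  rw [Units.smul_def, LinearMap.smul_apply, Pi.smul_apply, Module.End.mul_apply,
    twistedTranslation_apply, twistedTranslation_apply, twistedTranslation_apply, smul_eq_mul,
    mul_inv_rev, mul_assoc h⁻¹]
  linear_combination (-f ⟨h⁻¹ * (g⁻¹ * x.down)⟩) * this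

theorem twistedTranslation_one (c : G × G → Kˣ)
    (hc : ∀ g h j, c (g * h, j) * c (g, h) = c (h, j) * c (g, h * j)) :
    (1 : Module.End K (ULift.{w} G → K)) = (c (1, 1))⁻¹ • twistedTranslation c 1 := by
  ext f x
  have h1 : c (1, x.down) = c (1, 1) := by
    have := hc 1 1 x.down
    simp only [one_mul] at this
    exact (mul_left_cancel this).symm
  rw [Units.smul_def, LinearMap.smul_apply, Pi.smul_apply, twistedTranslation_apply, inv_one,
    one_mul, h1, smul_eq_mul, Units.inv_mul_cancel_left]
  rfl

/-- Applied to the delta function at 1, the translation by g gives c(g,1) times the delta function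
at g. -/
theorem linearIndependent_twistedTranslation (c : G × G → Kˣ) :
    LinearIndependent K (twistedTranslation.{w} c) := by
  classical
  let ev : Module.End K (ULift.{w} G → K) →ₗ[K] (ULift.{w} G → K) :=
    LinearMap.applyₗ (Pi.single ⟨1⟩ 1)
  have h : ev ∘ twistedTranslation c =
      (fun g => c (g, 1)) • fun g => (Pi.single ⟨g⟩ 1 : ULift.{w} G → K) := by
    funext g x
    change (c (g, g⁻¹ * x.down) : K) * (Pi.single ⟨1⟩ 1 : ULift.{w} G → K) ⟨g⁻¹ * x.down⟩ =
      (c (g, 1) : K) * (Pi.single ⟨g⟩ 1 : ULift.{w} G → K) x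
    obtain ⟨x⟩ := x
    by_cases hx : x = g
    · subst hx
      simp
    · rw [Pi.single_eq_of_ne, Pi.single_eq_of_ne]
      · simp
      · simpa using hx
      · simpa [inv_mul_eq_one] using Ne.symm hx
  refine LinearIndependent.of_comp ev ?_
  rw [h]
  refine LinearIndependent.units_smul ?_ _
  exact (Pi.linearIndependent_single_one (ULift.{w} G) K).comp ULift.up ULift.up_injective

/-- The span of the twisted translations. -/
def twistedGroupAlgebra (c : G × G → Kˣ)
    (hc : ∀ g h j, c (g * h, j) * c (g, h) = c (h, j) * c (g, h * j)) :
    Subalgebra K (Module.End K (ULift.{w} G → K)) :=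
  (Submodule.span K (Set.range (twistedTranslation.{w} c))).toSubalgebra
    (by
      rw [twistedTranslation_one c hc]
      exact Submodule.smul_mem _ _ (Submodule.subset_span ⟨1, rfl⟩))
    (fun x y hx hy => by
      have h := Submodule.mul_mem_mul hx hy
      rw [Submodule.span_mul_span] at h
      refine Submodule.span_le.2 ?_ h
      rintro _ ⟨_, ⟨g, rfl⟩, _, ⟨h, rfl⟩, rfl⟩
      simp only [twistedTranslation_mul c hc]
      exact Submodule.smul_mem _ _ (Submodule.subset_span ⟨g * h, rfl⟩))

/-- The basis of twisted translations. -/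
noncomputable def twistedBasis (c : G × G → Kˣ)
    (hc : ∀ g h j, c (g * h, j) * c (g, h) = c (h, j) * c (g, h * j)) :
    Module.Basis G K (twistedGroupAlgebra.{w} c hc) :=
  Module.Basis.span (linearIndependent_twistedTranslation.{w} c)

theorem coe_twistedBasis (c : G × G → Kˣ)
    (hc : ∀ g h j, c (g * h, j) * c (g, h) = c (h, j) * c (g, h * j)) (g : G) :
    (twistedBasis.{w} c hc g : Module.End K (ULift.{w} G → K)) = twistedTranslation c g :=
  congrArg Subtype.val (Module.Basis.span_apply (linearIndependent_twistedTranslation.{w} c) g)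

theorem twistedBasis_mul (c : G × G → Kˣ)
    (hc : ∀ g h j, c (g * h, j) * c (g, h) = c (h, j) * c (g, h * j)) (g h : G) :
    twistedBasis.{w} c hc g * twistedBasis c hc h = c (g, h) • twistedBasis c hc (g * h) := by
  apply Subtype.ext
  rw [Units.smul_def, Subalgebra.coe_mul, Subalgebra.coe_smul, coe_twistedBasis,
    coe_twistedBasis, coe_twistedBasis, twistedTranslation_mul c hc, Units.smul_def]

theorem one_mem_span_twistedBasis (c : G × G → Kˣ)
    (hc : ∀ g h j, c (g * h, j) * c (g, h) = c (h, j) * c (g, h * j)) :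
    (1 : twistedGroupAlgebra.{w} c hc) ∈ Submodule.span K {twistedBasis c hc 1} := by
  refine Submodule.mem_span_singleton.2 ⟨((c (1, 1))⁻¹ : Kˣ), Subtype.ext ?_⟩
  rw [Subalgebra.coe_smul, coe_twistedBasis, Subalgebra.coe_one, twistedTranslation_one c hc,
    Units.smul_def]

/-- Every cocycle is the family of structure constants of an associative graded twisted algebra. -/
theorem exists_isAssociative_isFrame (c : G × G → Kˣ)
    (hc : ∀ g h j, c (g * h, j) * c (g, h) = c (h, j) * c (g, h * j)) :
    ∃ (W : GradedTwistedAlgebra.{0, 0, w} G K) (x : G → W.carrier),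
      W.IsAssociative ∧ W.IsFrame x c := by
  let R := twistedGroupAlgebra.{w} c hc
  let _ : Ring R := inferInstance
  let _ : Algebra K R := inferInstance
  let b : Module.Basis G K R := twistedBasis.{w} c hc
  have h1 : ∀ g h, b g * b h = c (g, h) • b (g * h) := twistedBasis_mul.{w} c hc
  have h2 : (1 : R) ∈ Submodule.span K {b 1} := one_mem_span_twistedBasis.{w} c hc
  exact exists_isFrame_of_basis (R := R) b c h1 h2

end TwistedGroupAlgebra

/-! ### Isomorphism classes as cohomology classes -/

section Classification

open groupCohomology

variable {G : Type} [CommGroup G] {K : Type} [Field K]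

/-- The cocycle of structure constants of a frame of an associative algebra. -/
def IsFrame.toCocycle {W : GradedTwistedAlgebra.{0, 0, w} G K} {x : G → W.carrier}
    {c : G × G → Kˣ} (hx : W.IsFrame x c) (hW : W.IsAssociative) :
    cocycles₂ (Rep.trivial ℤ G (Additive Kˣ)) :=
  ⟨fun p => Additive.ofMul (c p), (mem_cocycles₂_trivial_iff _).2 (hx.cocycle hW)⟩

theorem IsFrame.gradedIsomorphic_iff_H2π_eq {W V : GradedTwistedAlgebra.{0, 0, w} G K}
    {x : G → W.carrier} {y : G → V.carrier} {c d : G × G → Kˣ}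
    (hx : W.IsFrame x c) (hW : W.IsAssociative) (hy : V.IsFrame y d) (hV : V.IsAssociative) :
    GradedIsomorphic W V ↔
      H2π (Rep.trivial ℤ G (Additive Kˣ)) (hx.toCocycle hW) =
        H2π (Rep.trivial ℤ G (Additive Kˣ)) (hy.toCocycle hV) := by
  rw [hx.gradedIsomorphic_iff hy, H2π_eq_iff]
  refine Iff.trans ?_ (mem_coboundaries₂_trivial_iff _).symm
  refine exists_congr fun f => forall₂_congr fun a b => ?_
  change _ ↔ c (a, b) / d (a, b) = f b / f (a * b) * f a
  rw [div_mul_eq_mul_div, div_eq_div_iff_mul_eq_mul, mul_comm (f b)]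

/-- The cohomology class of an associative graded twisted algebra. -/
noncomputable def cohomologyClass
    (W : {W : GradedTwistedAlgebra.{0, 0, w} G K // W.IsAssociative}) :
    groupCohomology (Rep.trivial ℤ G (Additive Kˣ)) 2 :=
  H2π (Rep.trivial ℤ G (Additive Kˣ)) (W.1.exists_isFrame.choose_spec.choose_spec.toCocycle W.2)

/-- Associative graded twisted algebras are classified by the second cohomology group. -/
theorem nonempty_associativeClasses_equiv :
    Nonempty (AssociativeClasses.{0, 0, w} G K ≃
      groupCohomology (Rep.trivial ℤ G (Additive Kˣ)) 2) := by
  have key : ∀ W V : {W : GradedTwistedAlgebra.{0, 0, w} G K // W.IsAssociative},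
      GradedIsomorphic W.1 V.1 ↔ cohomologyClass W = cohomologyClass V := fun W V =>
    IsFrame.gradedIsomorphic_iff_H2π_eq _ W.2 _ V.2
  refine ⟨Equiv.ofBijective
    (Quotient.lift (s := associativeSetoid G K) cohomologyClass fun W V h => (key W V).1 h)
    ⟨?_, fun z => ?_⟩⟩
  · rintro ⟨W⟩ ⟨V⟩ h
    exact Quotient.sound ((key W V).2 h)
  · induction z using H2_induction_on with
    | h c =>
      obtain ⟨W, x, hW, hx⟩ := exists_isAssociative_isFrame (fun p => (c p).toMul)
        ((mem_cocycles₂_trivial_iff _).1 c.2)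
      refine ⟨Quotient.mk _ ⟨W, hW⟩, ?_⟩
      exact (IsFrame.gradedIsomorphic_iff_H2π_eq _ hW hx hW).1
        (gradedIsomorphic_equivalence.refl W)

end Classification

end GradedTwistedAlgebra

theorem mainTheorem4 (k : ℕ) (n : Fin k → ℕ) (hn : ∀ i, 0 < n i)
    (G : Type) [CommGroup G] (e : G ≃* ((i : Fin k) → Multiplicative (ZMod (n i)))) :
    Nonempty (groupCohomology (Rep.trivial ℤ G (Additive ℂˣ)) 2 ≃+
      ⨁ p : {p : Fin k × Fin k // p.1 < p.2}, ZMod (Nat.gcd (n p.1.1) (n p.1.2))) ∧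
    Nat.card (GradedTwistedAlgebra.AssociativeClasses.{0, 0, w} G ℂ) =
      ∏ p : {p : Fin k × Fin k // p.1 < p.2}, Nat.gcd (n p.1.1) (n p.1.2) := by
  obtain ⟨E⟩ := nonempty_pi_addEquiv_groupCohomology hn e
  obtain ⟨F⟩ := GradedTwistedAlgebra.nonempty_associativeClasses_equiv.{w} (G := G) (K := ℂ)
  refine ⟨⟨E.symm.trans (DirectSum.addEquivProd _).symm⟩, ?_⟩
  rw [Nat.card_congr (F.trans E.symm.toEquiv), Nat.card_pi]
  exact Finset.prod_congr rfl fun p _ => Nat.card_zmod _
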